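/- For a closed set $P\subset\mathbb R^n$ write $P-x=\{p-x: p\in P\}$ and $B_r[P]=B(0,r)\cap P$, with $B(0,r)$ the open ball. Closed subsets of $\mathbb R^n$ are compared by the metric $$D(P,Q)=\inf\{\epsilon>0 : d_H\big(B_{1/\epsilon}[P]\cup\partial B(0,1/\epsilon),\ B_{1/\epsilon}[Q]\cup\partial B(0,1/\epsilon)\big)\le\epsilon\},$$ where $d_H$ is the Hausdorff distance. The continuous hull $\Omega_P$ is the $D$-closure of $\{P-x : x\in\mathbb R^n\}$ and the canonical transversal $\Xi_P$ is the $D$-closure of $\{P-p : p\in P\}$. A Delone set is a uniformly discrete and relatively dense set. $P$ has finite local complexity (FLC) if for every $r$ there are only finitely many distinct sets $B_r[P-x]$, $x\in P$. $P$ is aperiodic if $P-x=P$ implies $x=0$. A function $f$ on $\mathbb R^n$ is strongly $P$-equivariant if there is a finite $R>0$ such that for all $x,y\in\mathbb R^n$, $B_R[P-x]=B_R[P-y]$ implies $f(x)=f(y)$. **Theorem.** Let $P,P'\subset\mathbb R^n$ be aperiodic Delone sets of finite local complexity, and let $\Phi:\Omega_P\to\Omega_{P'}$ be a continuous map with $\Phi(\Xi_P)\subset\Xi_{P'}$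 and $\Phi(P)=P'$. Then there is a unique function $\varphi_P:\mathbb R^n\to\mathbb R^n$ (the orbit-displacement map of $\Phi$) such that $$\Phi(P-x)=P'-\varphi_P(x)\quad\text{for all }x\in\mathbb R^n,\qquad \varphi_P(0)=0,$$ and there exists a smooth function $\varphi:\mathbb R^n\to\mathbb R^n$ whose differential $d\varphi$ is strongly $P$-equivariant, with $\varphi(p)=\varphi_P(p)$ for all $p\in P$, and $\varphi(P)\subset P'$. -/

import Mathlib

open Set Metric Topology
open scoped ENNReal ContDiff

/-- Euclidean space `ℝⁿ`. -/
abbrev Euc (n : ℕ) : Type := EuclideanSpace ℝ (Fin n)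

/-- A pattern in `ℝⁿ`: a closed subset of `ℝⁿ`. (This is not Mathlib's type of closed subsets, which
already carries the Hausdorff distance as its metric.) -/
@[ext]
structure Pattern (n : ℕ) where
  carrier : Set (Euc n)
  isClosed : IsClosed carrier

namespace Pattern

variable {n : ℕ}

/-- The translate `P - x = {p - x | p ∈ P}`. -/
def translate (P : Pattern n) (x : Euc n) : Pattern n where
  carrier := {y | y + x ∈ P.carrier}
  isClosed := P.isClosed.preimage (by fun_prop : Continuous fun y : Euc n => y + x)

@[simp] theorem translate_zero (P : Pattern n) : P.translate 0 = P := by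
  ext y; simp [translate]

theorem translate_carrier (P : Pattern n) (x : Euc n) :
    (P.translate x).carrier = (fun p => p - x) '' P.carrier := by
  ext y
  constructor
  · intro h
    exact ⟨y + x, h, by simp⟩
  · rintro ⟨p, hp, rfl⟩
    simpa [translate] using hp

/-- The `r`-patch `B_r[P] = B(0, r) ∩ P` around the origin, `B(0, r)` being the open ball. -/
def patch (r : ℝ) (P : Pattern n) : Set (Euc n) := ball 0 r ∩ P.carrier

/-- `P` and `Q` are `ε`-close: the Hausdorff distance between `B_{1/ε}[P] ∪ ∂B(0, 1/ε)` and
`B_{1/ε}[Q] ∪ ∂B(0, 1/ε)` is at most `ε`. -/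
def IsClose (ε : ℝ) (P Q : Pattern n) : Prop :=
  hausdorffEDist (patch (1 / ε) P ∪ sphere 0 (1 / ε)) (patch (1 / ε) Q ∪ sphere 0 (1 / ε))
    ≤ ENNReal.ofReal ε

/-- The distance `D(P, Q)`: the infimum of all `ε > 0` such that `P` and `Q` are `ε`-close. -/
noncomputable def patternEDist (P Q : Pattern n) : ℝ≥0∞ :=
  ⨅ (ε : ℝ) (_ : 0 < ε) (_ : IsClose ε P Q), ENNReal.ofReal ε

theorem IsClose.symm {ε : ℝ} {P Q : Pattern n} (h : IsClose ε P Q) : IsClose ε Q P := by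
  unfold IsClose at *
  rwa [hausdorffEDist_comm]

theorem patternEDist_lt_iff {P Q : Pattern n} {c : ℝ≥0∞} :
    patternEDist P Q < c ↔ ∃ ε : ℝ, 0 < ε ∧ IsClose ε P Q ∧ ENNReal.ofReal ε < c := by
  simp only [patternEDist, iInf_lt_iff, exists_prop]

/-- A segment from the closed ball of radius `r` to its exterior meets the sphere. -/
theorem exists_mem_sphere {x y : Euc n} {r : ℝ} (hx : ‖x‖ ≤ r) (hy : r ≤ ‖y‖) :
    ∃ z ∈ sphere (0 : Euc n) r, dist x z ≤ dist x y := by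
  have hc : ContinuousOn (fun t : ℝ => ‖x + t • (y - x)‖) (Icc 0 1) := by fun_prop
  have h := intermediate_value_Icc (zero_le_one' ℝ) hc
  obtain ⟨t, ht, hzt⟩ := h (show r ∈ Icc _ _ from ⟨by simpa using hx, by simpa using hy⟩)
  refine ⟨x + t • (y - x), by simpa using hzt, ?_⟩
  rw [dist_self_add_right, norm_smul, dist_comm x y, dist_eq_norm y x, Real.norm_of_nonneg ht.1]
  exact mul_le_of_le_one_left (norm_nonneg _) ht.2

theorem IsClose.exists_near {ε δ : ℝ} {P Q : Pattern n} (h : IsClose ε P Q) (hε : 0 < ε)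
    (hδ : ε < δ) {x : Euc n} (hx : x ∈ P.carrier) (hr : ‖x‖ < 1 / ε) :
    ∃ y, (y ∈ Q.carrier ∨ 1 / ε ≤ ‖y‖) ∧ dist x y < δ := by
  have hlt := lt_of_le_of_lt h ((ENNReal.ofReal_lt_ofReal_iff (hε.trans hδ)).2 hδ)
  obtain ⟨y, hy, hxy⟩ := exists_edist_lt_of_hausdorffEDist_lt
    (x := x) (Or.inl ⟨by simpa using hr, hx⟩) hlt
  refine ⟨y, ?_, ?_⟩
  · rcases hy with hy | hy
    · exact Or.inl hy.2
    · exact Or.inr (by simpa using (mem_sphere_zero_iff_norm.1 hy).ge)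
  · rw [edist_dist] at hxy
    exact (ENNReal.ofReal_lt_ofReal_iff (hε.trans hδ)).1 hxy

theorem IsClose.trans_aux {a b c : ℝ} {P Q S : Pattern n} (ha : 0 < a) (hb : 0 < b)
    (hc : a + b < c) (hPQ : IsClose a P Q) (hQS : IsClose b Q S) :
    ∀ x ∈ patch (1 / c) P ∪ sphere 0 (1 / c), ∃ y ∈ patch (1 / c) S ∪ sphere 0 (1 / c),
      edist x y ≤ ENNReal.ofReal c := by
  have hac : 1 / c < 1 / a := one_div_lt_one_div_of_lt ha (by linarith)
  have hbc : 1 / c < 1 / b := one_div_lt_one_div_of_lt hb (by linarith)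
  rintro x (⟨hx, hxP⟩ | hx)
  swap
  · exact ⟨x, Or.inr hx, by simp⟩
  rw [mem_ball_zero_iff] at hx
  obtain ⟨y, hy, hxy⟩ := hPQ.exists_near (δ := a + (c - a - b) / 2) ha (by linarith) hxP
    (hx.trans hac)
  by_cases hyn : 1 / c ≤ ‖y‖
  · obtain ⟨z, hz, hxz⟩ := exists_mem_sphere hx.le hyn
    refine ⟨z, Or.inr hz, ?_⟩
    rw [edist_dist]
    exact ENNReal.ofReal_le_ofReal (by linarith)
  · have hyQ : y ∈ Q.carrier := hy.resolve_right (by linarith)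
    push Not at hyn
    obtain ⟨z, hz, hyz⟩ := hQS.exists_near (δ := b + (c - a - b) / 2) hb (by linarith) hyQ
      (hyn.trans hbc)
    by_cases hzn : 1 / c ≤ ‖z‖
    · obtain ⟨w, hw, hyw⟩ := exists_mem_sphere hyn.le hzn
      refine ⟨w, Or.inr hw, ?_⟩
      rw [edist_dist]
      exact ENNReal.ofReal_le_ofReal (by linarith [dist_triangle x y w])
    · refine ⟨z, Or.inl ⟨by simpa using hzn, hz.resolve_right (by linarith)⟩, ?_⟩
      rw [edist_dist]
      exact ENNReal.ofReal_le_ofReal (by linarith [dist_triangle x y z])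

theorem IsClose.trans {a b c : ℝ} {P Q S : Pattern n} (ha : 0 < a) (hb : 0 < b)
    (hc : a + b < c) (hPQ : IsClose a P Q) (hQS : IsClose b Q S) : IsClose c P S := by
  refine hausdorffEDist_le_of_mem_edist (hPQ.trans_aux ha hb hc hQS) ?_
  exact hQS.symm.trans_aux hb ha (by linarith) hPQ.symm

theorem patternEDist_triangle (P Q S : Pattern n) :
    patternEDist P S ≤ patternEDist P Q + patternEDist Q S := by
  refine ENNReal.le_of_forall_pos_le_add fun δ hδ hfin => ?_
  have hfin' := ENNReal.add_lt_top.1 hfin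
  have hδ3 : (ENNReal.ofReal (δ / 3)) ≠ 0 := by
    have : (0 : ℝ) < δ := hδ
    rw [Ne, ENNReal.ofReal_eq_zero]; linarith
  obtain ⟨a, ha, hPQ, hau⟩ := patternEDist_lt_iff.1 (ENNReal.lt_add_right hfin'.1.ne hδ3)
  obtain ⟨b, hb, hQS, hbv⟩ := patternEDist_lt_iff.1 (ENNReal.lt_add_right hfin'.2.ne hδ3)
  have hδ' : (0 : ℝ) < δ := hδ
  have hcl := hPQ.trans (c := a + b + δ / 3) ha hb (by linarith) hQS
  have hle : patternEDist P S ≤ ENNReal.ofReal (a + b + δ / 3) :=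
    iInf_le_of_le _ (iInf_le_of_le (by positivity) (iInf_le_of_le hcl le_rfl))
  have hd : (δ : ℝ≥0∞) = ENNReal.ofReal (δ / 3) + ENNReal.ofReal (δ / 3)
      + ENNReal.ofReal (δ / 3) := by
    rw [← ENNReal.ofReal_add (by positivity) (by positivity),
      ← ENNReal.ofReal_add (by positivity) (by positivity)]
    rw [show (δ : ℝ) / 3 + δ / 3 + δ / 3 = δ by ring, ENNReal.ofReal_coe_nnreal]
  calc patternEDist P S ≤ ENNReal.ofReal (a + b + δ / 3) := hle
    _ = ENNReal.ofReal a + ENNReal.ofReal b + ENNReal.ofReal (δ / 3) := by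
      rw [ENNReal.ofReal_add (by positivity) (by positivity), ENNReal.ofReal_add ha.le hb.le]
    _ ≤ (patternEDist P Q + ENNReal.ofReal (δ / 3)) + (patternEDist Q S + ENNReal.ofReal (δ / 3))
        + ENNReal.ofReal (δ / 3) := by gcongr
    _ = patternEDist P Q + patternEDist Q S + δ := by rw [hd]; ring

theorem patternEDist_self (P : Pattern n) : patternEDist P P = 0 := by
  refine le_antisymm (ENNReal.le_of_forall_pos_le_add fun δ hδ _ => ?_) bot_le
  have hcl : IsClose (δ : ℝ) P P := by simp [IsClose]
  rw [zero_add]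
  exact iInf_le_of_le (δ : ℝ) (iInf_le_of_le (by exact_mod_cast hδ)
    (iInf_le_of_le hcl (by simp)))

theorem patternEDist_comm (P Q : Pattern n) : patternEDist P Q = patternEDist Q P := by
  have h : ∀ ε : ℝ, IsClose ε P Q ↔ IsClose ε Q P := fun ε => ⟨.symm, .symm⟩
  simp [patternEDist, h]

theorem subset_of_patternEDist_eq_zero {P Q : Pattern n} (h : patternEDist P Q = 0) :
    P.carrier ⊆ Q.carrier := by
  intro x hx
  rw [← Q.isClosed.closure_eq, Metric.mem_closure_iff]
  intro δ hδ
  have hpos : 0 < ‖x‖ + δ := by positivity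
  have hm : (0 : ℝ≥0∞) < ENNReal.ofReal (min δ (1 / (‖x‖ + δ))) := by
    rw [ENNReal.ofReal_pos]; positivity
  obtain ⟨ε, hε, hcl, hlt⟩ := patternEDist_lt_iff.1 (h.trans_lt hm)
  rw [ENNReal.ofReal_lt_ofReal_iff (by positivity), lt_min_iff] at hlt
  have hr : ‖x‖ + δ < 1 / ε := by
    rw [lt_one_div hpos hε]; exact hlt.2
  obtain ⟨y, hy, hxy⟩ := hcl.exists_near hε hlt.1 hx (by linarith)
  refine ⟨y, hy.resolve_right fun hy => ?_, hxy⟩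
  have := norm_sub_norm_le y x
  rw [← dist_eq_norm, dist_comm] at this
  linarith

/-- Patterns are always compared through the distance `D`; the topology on them is the one of `D`. -/
noncomputable instance : EMetricSpace (Pattern n) where
  edist := patternEDist
  edist_self := patternEDist_self
  edist_comm := patternEDist_comm
  edist_triangle := patternEDist_triangle
  eq_of_edist_eq_zero {P Q} h :=
    Pattern.ext ((subset_of_patternEDist_eq_zero h).antisymm
      (subset_of_patternEDist_eq_zero ((patternEDist_comm Q P).trans h)))

/-- `P` is a Delone set: uniformly discrete and relatively dense. -/
def IsDelone (P : Pattern n) : Prop :=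
  ∃ D : Delone.DeloneSet (Euc n), D.carrier = P.carrier

/-- Finite local complexity: for every `r` there are only finitely many distinct `r`-patches
`B_r[P - x]` with `x ∈ P`. -/
def HasFLC (P : Pattern n) : Prop :=
  ∀ r : ℝ, {A : Set (Euc n) | ∃ x ∈ P.carrier, A = patch r (P.translate x)}.Finite

/-- `P` is aperiodic: it has no non-zero period. -/
def IsAperiodic (P : Pattern n) : Prop :=
  ∀ x : Euc n, P.translate x = P → x = 0

/-- The continuous hull `Ω_P`: the `D`-closure of the orbit `{P - x | x ∈ ℝⁿ}`. -/
def hull (P : Pattern n) : Set (Pattern n) :=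
  closure {Q | ∃ x : Euc n, Q = P.translate x}

/-- The discrete hull (canonical transversal) `Ξ_P`: the `D`-closure of `{P - p | p ∈ P}`. -/
def discreteHull (P : Pattern n) : Set (Pattern n) :=
  closure {Q | ∃ p ∈ P.carrier, Q = P.translate p}

theorem translate_mem_hull (P : Pattern n) (x : Euc n) : P.translate x ∈ P.hull :=
  subset_closure ⟨x, rfl⟩

/-- The point `P - x` of the hull of `P`. -/
def orbitPoint (P : Pattern n) (x : Euc n) : P.hull := ⟨P.translate x, P.translate_mem_hull x⟩

/-- `P` as a point of its own hull. -/
def basePoint (P : Pattern n) : P.hull := ⟨P, by simpa using P.translate_mem_hull 0⟩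

/-- A function `f` on `ℝⁿ` is strongly `P`-equivariant: for some finite range `R`, equality
`B_R[P - x] = B_R[P - y]` of patches implies `f x = f y`. -/
def StronglyEquivariant {X : Type*} (P : Pattern n) (f : Euc n → X) : Prop :=
  ∃ R : ℝ, 0 < R ∧ ∀ x y : Euc n,
    patch R (P.translate x) = patch R (P.translate y) → f x = f y

/-- `ψ` is an orbit-displacement map of `Φ : Ω_P → Ω_{P'}` at `P`:
`Φ (P - x) = P' - ψ x` for all `x`, and `ψ 0 = 0`. -/
def IsOrbitDisplacement {P P' : Pattern n} (Φ : P.hull → P'.hull) (ψ : Euc n → Euc n) : Prop :=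
  (∀ x : Euc n, Φ (P.orbitPoint x) = P'.orbitPoint (ψ x)) ∧ ψ 0 = 0

end Pattern

/-!
Let `Γ x = Φ (P - x)`, a continuous map from `ℝⁿ` to the hull of `P'`. The displacement map exists
because such a map cannot leave an orbit. By finite local complexity, the difference set `P' - P'`
is locally finite, hence closed, and it contains all differences of points of any pattern in the
hull. Follow one point `p x ∈ Γ x` continuously over a small connected neighbourhood: every other
point of `Γ x` differs from `p x` by an element of a discrete set, so `Γ x - p x` is constant
(`translate_eq_of_isPreconnected`). Hence `Γ` moves by a continuous translation near each point, the
set of `x` with `Γ x` in the orbit of `P'` is open and closed, and aperiodicity of `P'` makes the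
displacement `F` unique and continuous. All elements of the discrete hull of `P'` contain the
origin, so `F p ∈ P'` for `p ∈ P`.

The space of patterns is compact (limits are taken along ultrafilters), so `Φ` is uniformly
continuous. Therefore `F` has bounded increments over bounded distances, and if `P` looks the same
around `x` and `y` on a large ball, `P' - F (x + w)` and `P' - F (y + w)` are close on a large ball
for all `w` of bounded norm. For `x, y ∈ P`, the point of `P' - F (y + w)` close to
`F x - F (x + w)` is then `F y - F (y + w)` for all these `w`, by connectedness. When `x + w ∈ P` too, both are bounded elements of
`P' - P'`, so they are equal: increments of `F` on `P` are determined by patches of `P`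
(`IsOrbitDisplacement.exists_increment_eq`).

Finally, `F` on `P` is interpolated with smooth weights that add up to one, depend only on the local
patch, and are Kronecker deltas on `P` (`exists_contDiff_extension`). Since the weights add up to
one, agreement of the increments of `F` near `x` and `y` makes the interpolation near `x` a
translate, up to a constant, of the one near `y`; its differential is strongly equivariant.
-/

/-! ### The topology of the space of patterns -/

namespace Pattern

variable {n : ℕ}

/-- Every point of `P` of norm at most `W` is `ε`-close to a point of `Q`. The relations
`Near W ε P Q ∧ Near W ε Q P` form a basis of the uniformity of `D`, without the sphere that appears
in the definition of `D`. -/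
def Near (W ε : ℝ) (P Q : Pattern n) : Prop :=
  ∀ x ∈ P.carrier, ‖x‖ ≤ W → ∃ y ∈ Q.carrier, dist x y < ε

theorem mem_translate {P : Pattern n} {x y : Euc n} :
    y ∈ (P.translate x).carrier ↔ y + x ∈ P.carrier := Iff.rfl

theorem translate_translate (P : Pattern n) (a b : Euc n) :
    (P.translate a).translate b = P.translate (b + a) := by
  ext y
  simp only [mem_translate, add_assoc]

theorem exists_near_of_edist_lt (W : ℝ) {ε : ℝ} (hε : 0 < ε) :
    ∃ δ : ℝ≥0∞, 0 < δ ∧ ∀ P Q : Pattern n, edist P Q < δ → Near W ε P Q := by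
  have hW : 0 < |W| + ε := by positivity
  refine ⟨ENNReal.ofReal (min ε (1 / (|W| + ε))), by rw [ENNReal.ofReal_pos]; positivity, ?_⟩
  intro P Q h x hx hxW
  obtain ⟨a, ha, hcl, hlt⟩ := patternEDist_lt_iff.1 h
  rw [ENNReal.ofReal_lt_ofReal_iff (by positivity), lt_min_iff] at hlt
  have hr : |W| + ε < 1 / a := by
    rw [lt_one_div hW ha]; exact hlt.2
  have := le_abs_self W
  obtain ⟨y, hy, hxy⟩ := hcl.exists_near ha hlt.1 hx (by linarith)
  refine ⟨y, hy.resolve_right fun hy => ?_, hxy⟩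
  have := norm_sub_norm_le y x
  rw [← dist_eq_norm, dist_comm] at this
  linarith

theorem edist_le_of_near {ε : ℝ} (hε : 0 < ε) {P Q : Pattern n} (hPQ : Near (1 / ε) ε P Q)
    (hQP : Near (1 / ε) ε Q P) : edist P Q ≤ ENNReal.ofReal ε := by
  have key : ∀ S T : Pattern n, Near (1 / ε) ε S T →
      ∀ x ∈ patch (1 / ε) S ∪ sphere 0 (1 / ε), ∃ y ∈ patch (1 / ε) T ∪ sphere 0 (1 / ε),
        edist x y ≤ ENNReal.ofReal ε := by
    rintro S T h x (⟨hx, hxS⟩ | hx)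
    swap
    · exact ⟨x, Or.inr hx, by simp⟩
    rw [mem_ball_zero_iff] at hx
    obtain ⟨y, hy, hxy⟩ := h x hxS hx.le
    by_cases hyn : 1 / ε ≤ ‖y‖
    · obtain ⟨z, hz, hxz⟩ := exists_mem_sphere hx.le hyn
      refine ⟨z, Or.inr hz, ?_⟩
      rw [edist_dist]
      exact ENNReal.ofReal_le_ofReal (by linarith)
    · refine ⟨y, Or.inl ⟨by simpa using hyn, hy⟩, ?_⟩
      rw [edist_dist]
      exact ENNReal.ofReal_le_ofReal hxy.le
  have hcl : IsClose ε P Q := hausdorffEDist_le_of_mem_edist (key P Q hPQ) (key Q P hQP)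
  exact iInf_le_of_le ε (iInf_le_of_le hε (iInf_le_of_le hcl le_rfl))

theorem exists_edist_lt_of_near {δ : ℝ≥0∞} (hδ : 0 < δ) :
    ∃ W ε : ℝ, 0 < ε ∧ ∀ P Q : Pattern n, Near W ε P Q → Near W ε Q P → edist P Q < δ := by
  obtain ⟨ε, hε, hlt⟩ : ∃ ε : ℝ, 0 < ε ∧ ENNReal.ofReal ε < δ := by
    obtain ⟨e, he0, he⟩ := ENNReal.lt_iff_exists_nnreal_btwn.1 hδ
    exact ⟨e, by exact_mod_cast he0, by simpa using he⟩
  exact ⟨1 / ε, ε, hε, fun P Q h h' => (edist_le_of_near hε h h').trans_lt hlt⟩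

theorem near_translate (P : Pattern n) {ε W : ℝ} {x y : Euc n} (h : dist x y < ε) :
    Near W ε (P.translate x) (P.translate y) := by
  intro z hz _
  refine ⟨z + x - y, by simpa [mem_translate] using hz, ?_⟩
  rwa [dist_eq_norm, show z - (z + x - y) = y - x by abel, ← dist_eq_norm, dist_comm]

theorem continuous_translate (P : Pattern n) : Continuous P.translate := by
  rw [EMetric.continuous_iff]
  intro x δ hδ
  obtain ⟨W, ε, hε, h⟩ := exists_edist_lt_of_near (n := n) hδ
  refine ⟨ENNReal.ofReal ε, by simpa using hε, fun y hy => ?_⟩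
  rw [edist_dist, ENNReal.ofReal_lt_ofReal_iff hε] at hy
  exact h _ _ (near_translate P hy) (near_translate P (by rwa [dist_comm]))

theorem eventually_near {X : Type*} [TopologicalSpace X] {γ : X → Pattern n} {x : X}
    (hγ : ContinuousAt γ x) (W : ℝ) {ε : ℝ} (hε : 0 < ε) :
    ∀ᶠ y in 𝓝 x, Near W ε (γ x) (γ y) ∧ Near W ε (γ y) (γ x) := by
  obtain ⟨δ, hδ, h⟩ := exists_near_of_edist_lt (n := n) W hε
  filter_upwards [hγ (eball_mem_nhds _ hδ)] with y hy
  exact ⟨h _ _ (by rw [edist_comm]; exact hy), h _ _ hy⟩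

/-- The limit of an ultrafilter of patterns: the points that almost all patterns approach. -/
def ultrafilterLim (U : Ultrafilter (Pattern n)) : Pattern n where
  carrier := {x | ∀ ε > 0, ∀ᶠ S in (U : Filter (Pattern n)), ∃ y ∈ S.carrier, dist x y < ε}
  isClosed := by
    refine isClosed_of_closure_subset fun x hx ε hε => ?_
    obtain ⟨z, hz, hxz⟩ := Metric.mem_closure_iff.1 hx (ε / 2) (half_pos hε)
    filter_upwards [hz (ε / 2) (half_pos hε)] with S ⟨y, hy, hzy⟩
    exact ⟨y, hy, by linarith [dist_triangle x z y]⟩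

theorem eventually_ultrafilterLim_near (U : Ultrafilter (Pattern n)) (W : ℝ) {ε : ℝ}
    (hε : 0 < ε) : ∀ᶠ S in (U : Filter (Pattern n)), Near W ε (ultrafilterLim U) S := by
  have hK : IsCompact (closedBall (0 : Euc n) W ∩ (ultrafilterLim U).carrier) :=
    (isCompact_closedBall _ _).inter_right (ultrafilterLim U).isClosed
  obtain ⟨t, htK, htf, hcov⟩ := hK.finite_cover_balls (half_pos hε)
  have hev : ∀ᶠ S in (U : Filter (Pattern n)), ∀ z ∈ t, ∃ y ∈ S.carrier, dist z y < ε / 2 :=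
    (Filter.eventually_all_finite htf).2 fun z hz => (htK hz).2 _ (half_pos hε)
  filter_upwards [hev] with S hS x hx hxW
  obtain ⟨z, hz, hxz⟩ := mem_iUnion₂.1 (hcov ⟨by simpa using hxW, hx⟩)
  obtain ⟨y, hy, hzy⟩ := hS z hz
  exact ⟨y, hy, by linarith [dist_triangle x z y, mem_ball.1 hxz]⟩

theorem eventually_near_ultrafilterLim (U : Ultrafilter (Pattern n)) (W : ℝ) {ε : ℝ}
    (hε : 0 < ε) : ∀ᶠ S in (U : Filter (Pattern n)), Near W ε S (ultrafilterLim U) := by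
  -- `K` is the part of the window that is far from the limit; almost all patterns avoid it.
  set K : Set (Euc n) := closedBall 0 W \ thickening ε (ultrafilterLim U).carrier with hKdef
  have hK : IsCompact K := (isCompact_closedBall _ _).diff isOpen_thickening
  have hev : ∀ᶠ S in (U : Filter (Pattern n)), ∀ x ∈ K, x ∉ S.carrier := by
    refine hK.induction_on (p := fun A => ∀ᶠ S in (U : Filter (Pattern n)), ∀ x ∈ A, x ∉ S.carrier)
      (by simp) (fun A B hAB h => h.mono fun S hS x hx => hS x (hAB hx))
      (fun A B hA hB => ?_) fun x hx => ?_
    · filter_upwards [hA, hB] with S hSA hSB x hx using hx.elim (hSA x) (hSB x)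
    · have hxQ : x ∉ (ultrafilterLim U).carrier := fun h =>
        hx.2 (self_subset_thickening hε _ h)
      have : ∃ r > 0, ¬ ∀ᶠ S in (U : Filter (Pattern n)), ∃ y ∈ S.carrier, dist x y < r := by
        by_contra! hcon
        exact hxQ hcon
      obtain ⟨r, hr, hnot⟩ := this
      rw [← Ultrafilter.eventually_not] at hnot
      refine ⟨ball x r, mem_nhdsWithin_of_mem_nhds (ball_mem_nhds x hr), ?_⟩
      filter_upwards [hnot] with S hS y hy hyS
      exact hS ⟨y, hyS, by rwa [dist_comm]⟩
  filter_upwards [hev] with S hS x hx hxW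
  by_contra! hcon
  refine hS x ⟨by simpa using hxW, fun h => ?_⟩ hx
  obtain ⟨y, hy, hxy⟩ := mem_thickening_iff.1 h
  exact absurd hxy (not_lt.2 (hcon y hy))

/-- The space of all closed subsets of `ℝⁿ` is compact for `D`: every ultrafilter converges to its
`ultrafilterLim`. Finite local complexity plays no role here. -/
instance : CompactSpace (Pattern n) := by
  refine ⟨isCompact_iff_ultrafilter_le_nhds.2 fun U _ => ⟨ultrafilterLim U, mem_univ _, ?_⟩⟩
  rw [(Metric.nhds_basis_eball).ge_iff]
  intro δ hδ
  obtain ⟨W, ε, hε, h⟩ := exists_edist_lt_of_near (n := n) hδ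
  filter_upwards [eventually_ultrafilterLim_near U W hε,
    eventually_near_ultrafilterLim U W hε] with S h1 h2
  exact h _ _ h2 h1

instance (P : Pattern n) : CompactSpace P.hull :=
  isCompact_iff_compactSpace.1 isClosed_closure.isCompact

end Pattern

/-! ### Delone sets, finite local complexity, and the patterns of the hull -/

namespace Pattern

variable {n : ℕ}

/-- The set `P - P` of differences of points of `P`. -/
def diffSet (P : Pattern n) : Set (Euc n) := {d | ∃ x ∈ P.carrier, ∃ y ∈ P.carrier, d = x - y}

/-- Only finitely many points of `S` lie in each ball about the origin. -/
def IsLocFinite (S : Set (Euc n)) : Prop := ∀ r : ℝ, (closedBall 0 r ∩ S).Finite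

theorem IsDelone.exists_separation {P : Pattern n} (hP : P.IsDelone) :
    ∃ s > 0, ∀ x ∈ P.carrier, ∀ y ∈ P.carrier, dist x y < s → x = y := by
  obtain ⟨D, hD⟩ := hP
  refine ⟨D.packingRadius, by exact_mod_cast D.packingRadius_pos, fun x hx y hy h => ?_⟩
  by_contra hne
  rw [← hD] at hx hy
  exact absurd (D.packingRadius_lt_dist_of_mem_ne hx hy hne) h.not_gt

theorem IsDelone.exists_covering {P : Pattern n} (hP : P.IsDelone) :
    ∃ ρ > 0, ∀ x : Euc n, ∃ y ∈ P.carrier, dist x y ≤ ρ := by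
  obtain ⟨D, hD⟩ := hP
  refine ⟨D.coveringRadius, by exact_mod_cast D.coveringRadius_pos, fun x => ?_⟩
  rw [← hD]
  exact D.exists_dist_le_coveringRadius x

theorem IsDelone.finite_inter_closedBall {P : Pattern n} (hP : P.IsDelone) (x : Euc n) (r : ℝ) :
    (closedBall x r ∩ P.carrier).Finite := by
  obtain ⟨s, hs, hsep⟩ := hP.exists_separation
  obtain ⟨t, -, htf, hcov⟩ := (isCompact_closedBall x r).finite_cover_balls (half_pos hs)
  refine (htf.biUnion (t := fun z => ball z (s / 2) ∩ P.carrier) fun z _ => ?_).subset ?_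
  · refine Set.Subsingleton.finite fun a ha b hb => hsep a ha.2 b hb.2 ?_
    linarith [dist_triangle_right a b z, mem_ball.1 ha.1, mem_ball.1 hb.1]
  · rintro y ⟨hy, hyP⟩
    obtain ⟨z, hz, hyz⟩ := mem_iUnion₂.1 (hcov hy)
    exact mem_iUnion₂.2 ⟨z, hz, hyz, hyP⟩

theorem HasFLC.isLocFinite_diffSet {P : Pattern n} (hflc : P.HasFLC) (hP : P.IsDelone) :
    IsLocFinite P.diffSet := by
  intro r
  have hfin := (hflc (r + 1)).biUnion (t := fun A => A) (by
    rintro A ⟨x, -, rfl⟩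
    refine ((hP.finite_inter_closedBall x (r + 1)).image fun p => p - x).subset ?_
    rintro y ⟨hy, hyP⟩
    refine ⟨y + x, ⟨?_, hyP⟩, by simp⟩
    simpa using (mem_ball_zero_iff.1 hy).le)
  refine hfin.subset ?_
  rintro d ⟨hd, x, hx, y, hy, rfl⟩
  refine mem_iUnion₂.2 ⟨_, ⟨y, hy, rfl⟩, ?_, by simpa [mem_translate] using hx⟩
  rw [mem_closedBall_zero_iff] at hd
  rw [mem_ball_zero_iff]
  linarith

theorem exists_gap {S : Set (Euc n)} (hS : S.Finite) : ∃ ε > 0, ∀ z ∈ S, ‖z‖ < ε → z = 0 := by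
  have hopen : IsOpen (S \ {0})ᶜ := (hS.subset sdiff_subset).isClosed.isOpen_compl
  obtain ⟨ε, hε, h⟩ := Metric.isOpen_iff.1 hopen 0 (by simp)
  refine ⟨ε, hε, fun z hz hzε => ?_⟩
  by_contra hne
  exact h (mem_ball_zero_iff.2 hzε) ⟨hz, hne⟩

/-- The points of a locally finite set in a bounded window have a common gap. -/
theorem IsLocFinite.exists_gap {S : Set (Euc n)} (hS : IsLocFinite S) (r : ℝ) :
    ∃ ε > 0, ∀ a ∈ S, ∀ b ∈ S, ‖a‖ ≤ r → ‖b‖ ≤ r → dist a b < ε → a = b := by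
  obtain ⟨ε, hε, h⟩ := Pattern.exists_gap ((hS r).image2 (fun a b => a - b) (hS r))
  refine ⟨ε, hε, fun a ha b hb har hbr hab => sub_eq_zero.1 (h _ ?_ (by rwa [← dist_eq_norm]))⟩
  exact ⟨a, ⟨by simpa using har, ha⟩, b, ⟨by simpa using hbr, hb⟩, rfl⟩

theorem IsLocFinite.isClosed {S : Set (Euc n)} (hS : IsLocFinite S) : IsClosed S := by
  refine isClosed_of_closure_subset fun x hx => ?_
  have : x ∈ closure (closedBall 0 (‖x‖ + 1) ∩ S) := by
    rw [Metric.mem_closure_iff] at hx ⊢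
    intro ε hε
    obtain ⟨y, hy, hxy⟩ := hx (min ε 1) (by positivity)
    refine ⟨y, ⟨?_, hy⟩, hxy.trans_le (min_le_left _ _)⟩
    rw [mem_closedBall_zero_iff]
    rw [dist_comm] at hxy
    exact norm_le_norm_add_const_of_dist_le (hxy.le.trans (min_le_right ε 1))
  rw [(hS _).isClosed.closure_eq] at this
  exact this.2

theorem exists_near_of_mem_closure {A : Set (Pattern n)} {Q : Pattern n} (hQ : Q ∈ closure A)
    (W : ℝ) {ε : ℝ} (hε : 0 < ε) : ∃ S ∈ A, Near W ε Q S ∧ Near W ε S Q := by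
  obtain ⟨S, hS, hA⟩ := mem_closure_iff_nhds.1 hQ _ (eventually_near continuousAt_id W hε)
  exact ⟨S, hA, hS⟩

theorem sub_mem_diffSet_of_mem_hull {P Q : Pattern n} (hloc : IsLocFinite P.diffSet)
    (hQ : Q ∈ P.hull) {x y : Euc n} (hx : x ∈ Q.carrier) (hy : y ∈ Q.carrier) :
    x - y ∈ P.diffSet := by
  rw [← hloc.isClosed.closure_eq, Metric.mem_closure_iff]
  intro ε hε
  obtain ⟨S, ⟨a, rfl⟩, hS, -⟩ :=
    exists_near_of_mem_closure hQ (max ‖x‖ ‖y‖) (half_pos hε)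
  obtain ⟨x', hx', hxx'⟩ := hS x hx (le_max_left _ _)
  obtain ⟨y', hy', hyy'⟩ := hS y hy (le_max_right _ _)
  refine ⟨x' - y', ⟨_, hx', _, hy', by abel⟩, ?_⟩
  linarith [dist_sub_sub_le x y x' y']

theorem nonempty_of_mem_hull {P Q : Pattern n} (hP : P.IsDelone) (hQ : Q ∈ P.hull) :
    Q.carrier.Nonempty := by
  obtain ⟨ρ, -, hρ⟩ := hP.exists_covering
  obtain ⟨S, ⟨a, rfl⟩, -, hS⟩ := exists_near_of_mem_closure hQ ρ one_pos
  obtain ⟨p, hp, hap⟩ := hρ a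
  obtain ⟨y, hy, -⟩ := hS (p - a) (by simpa [mem_translate] using hp)
    (by rwa [← dist_eq_norm, dist_comm])
  exact ⟨y, hy⟩

theorem zero_mem_of_mem_discreteHull {P Q : Pattern n} (hQ : Q ∈ P.discreteHull) :
    (0 : Euc n) ∈ Q.carrier := by
  rw [← Q.isClosed.closure_eq, Metric.mem_closure_iff]
  intro ε hε
  obtain ⟨S, ⟨p, hp, rfl⟩, -, hS⟩ := exists_near_of_mem_closure hQ 0 hε
  obtain ⟨y, hy, h⟩ := hS 0 (by simpa [mem_translate] using hp) (by simp)
  exact ⟨y, hy, h⟩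

/-! ### Continuous families of patterns in a hull move by translations -/

/-- A continuous family `Γ` of patterns whose difference sets lie in one locally finite set is
rigid along a continuous selection `p x ∈ Γ x`: a fixed vector `d` lies in `Γ y - p y` either for all
`y` close to `x` or for none. -/
theorem eventually_add_mem_iff {X : Type*} [TopologicalSpace X] {s : Set X} {Γ : X → Pattern n}
    {Δ : Set (Euc n)} (hΔ : IsLocFinite Δ)
    (hΓΔ : ∀ x ∈ s, ∀ q ∈ (Γ x).carrier, ∀ q' ∈ (Γ x).carrier, q - q' ∈ Δ) {p : X → Euc n}
    (hpΓ : ∀ x ∈ s, p x ∈ (Γ x).carrier) (d : Euc n) {x : X} (hx : x ∈ s)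
    (hΓ : ContinuousAt Γ x) (hp : ContinuousWithinAt p s x) :
    ∀ᶠ y in 𝓝[s] x, (d + p x ∈ (Γ x).carrier ↔ d + p y ∈ (Γ y).carrier) := by
  by_cases hd : d + p x ∈ (Γ x).carrier
  · have hdΔ : d ∈ Δ := by simpa using hΓΔ x hx _ hd _ (hpΓ x hx)
    obtain ⟨ε, hε, hgap⟩ := hΔ.exists_gap (‖d‖ + 1)
    have hε' : 0 < min ε 1 / 2 := by positivity
    filter_upwards [self_mem_nhdsWithin,
      (eventually_near hΓ ‖d + p x‖ hε').filter_mono nhdsWithin_le_nhds,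
      hp (ball_mem_nhds _ hε')] with y hys hy hpy
    obtain ⟨q, hq, hdq⟩ := hy.1 _ hd le_rfl
    have hdist : dist d (q - p y) < min ε 1 := by
      have h1 := dist_sub_sub_le (d + p x) (p x) q (p y)
      rw [add_sub_cancel_right] at h1
      have h2 : dist (p y) (p x) < min ε 1 / 2 := hpy
      rw [dist_comm] at h2
      linarith
    have hqd : d = q - p y := by
      refine hgap _ hdΔ _ (hΓΔ y hys _ hq _ (hpΓ y hys)) (by linarith) ?_
        (hdist.trans_le (min_le_left _ _))
      rw [dist_comm] at hdist
      exact norm_le_norm_add_const_of_dist_le (hdist.le.trans (min_le_right ε 1))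
    simp only [hd, true_iff]
    rw [hqd]
    simpa using hq
  · obtain ⟨ε, hε, hball⟩ := Metric.isOpen_iff.1 (Γ x).isClosed.isOpen_compl _ hd
    filter_upwards [(eventually_near hΓ (‖d + p x‖ + ε) (half_pos hε)).filter_mono
      nhdsWithin_le_nhds, hp (ball_mem_nhds _ (half_pos hε))] with y hy hpy
    simp only [hd, false_iff]
    intro hmem
    have h2 : dist (d + p y) (d + p x) < ε / 2 := by rw [dist_add_left]; exact hpy
    have hnorm : ‖d + p y‖ ≤ ‖d + p x‖ + ε :=
      norm_le_norm_add_const_of_dist_le (by linarith)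
    obtain ⟨q, hq, hdq⟩ := hy.2 _ hmem hnorm
    refine hball ?_ hq
    rw [mem_ball]
    rw [dist_comm] at hdq
    linarith [dist_triangle q (d + p y) (d + p x)]

/-- Over a preconnected set, `Γ x - p x` is constant. -/
theorem translate_eq_of_isPreconnected {X : Type*} [TopologicalSpace X] {s : Set X}
    (hs : IsPreconnected s) {Γ : X → Pattern n} (hΓ : Continuous Γ)
    {Δ : Set (Euc n)} (hΔ : IsLocFinite Δ)
    (hΓΔ : ∀ x ∈ s, ∀ q ∈ (Γ x).carrier, ∀ q' ∈ (Γ x).carrier, q - q' ∈ Δ) {p : X → Euc n}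
    (hpΓ : ∀ x ∈ s, p x ∈ (Γ x).carrier) (hp : ContinuousOn p s) {x y : X} (hx : x ∈ s)
    (hy : y ∈ s) : (Γ x).translate (p x) = (Γ y).translate (p y) := by
  ext d
  exact hs.induction₂ (fun x y => d + p x ∈ (Γ x).carrier ↔ d + p y ∈ (Γ y).carrier)
    (fun z hz => eventually_add_mem_iff hΔ hΓΔ hpΓ d hz hΓ.continuousAt (hp z hz))
    (fun _ _ _ _ _ _ h h' => h.trans h') (fun _ _ _ _ h => h.symm) hx hy

/-- In a continuous family of uniformly separated patterns, a point of one pattern can be followed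
continuously to the nearby ones. -/
theorem exists_local_selection {X : Type*} [TopologicalSpace X] {Γ : X → Pattern n}
    (hΓ : Continuous Γ) {s : ℝ} (hs : 0 < s)
    (hsep : ∀ x, ∀ q ∈ (Γ x).carrier, ∀ q' ∈ (Γ x).carrier, dist q q' < s → q = q')
    (x₀ : X) {p₀ : Euc n} (hp₀ : p₀ ∈ (Γ x₀).carrier) :
    ∃ U ∈ 𝓝 x₀, ∃ p : X → Euc n, p x₀ = p₀ ∧ (∀ x ∈ U, p x ∈ (Γ x).carrier) ∧
      ContinuousOn p U := by
  have hs4 : 0 < s / 4 := by positivity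
  set U : Set X := {x | ∃ q ∈ (Γ x).carrier, dist p₀ q < s / 4} with hU
  have hUn : U ∈ 𝓝 x₀ := by
    filter_upwards [eventually_near hΓ.continuousAt ‖p₀‖ hs4] with x hx using hx.1 p₀ hp₀ le_rfl
  choose! p hp using fun (x : X) (hx : x ∈ U) => hx
  refine ⟨U, hUn, p, ?_, fun x hx => (hp x hx).1, fun x hx => ?_⟩
  · have := hp x₀ (mem_of_mem_nhds hUn)
    exact (hsep x₀ _ hp₀ _ this.1 (by linarith)).symm
  · rw [ContinuousWithinAt, Metric.tendsto_nhds]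
    intro ε hε
    have hε' : 0 < min ε (s / 2) := by positivity
    filter_upwards [self_mem_nhdsWithin, (eventually_near hΓ.continuousAt ‖p x‖ hε').filter_mono
      nhdsWithin_le_nhds] with y hy hxy
    obtain ⟨q, hq, hd⟩ := hxy.1 _ (hp x hx).1 le_rfl
    have hqp : q = p y := by
      refine hsep y _ hq _ (hp y hy).1 ?_
      have h1 := dist_triangle4 q (p x) p₀ (p y)
      rw [dist_comm q (p x), dist_comm (p x) p₀] at h1
      linarith [(hp x hx).2, (hp y hy).2, hd.trans_le (min_le_right _ _)]
    rw [← hqp, dist_comm]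
    exact hd.trans_le (min_le_left _ _)

/-- Locally, a continuous family of patterns in the hull of an FLC Delone set moves by a continuous
translation. -/
theorem exists_local_translation {X : Type*} [TopologicalSpace X] [LocallyConnectedSpace X]
    {P : Pattern n} (hP : P.IsDelone) (hflc : P.HasFLC) {Γ : X → Pattern n} (hΓ : Continuous Γ)
    (hΓP : ∀ x, Γ x ∈ P.hull) (x₀ : X) :
    ∃ v : X → Euc n, v x₀ = 0 ∧ ContinuousAt v x₀ ∧
      ∀ᶠ x in 𝓝 x₀, Γ x = (Γ x₀).translate (v x) := by
  have hloc := hflc.isLocFinite_diffSet hP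
  obtain ⟨s, hs, hgap⟩ := hloc.exists_gap 1
  have hsep : ∀ x, ∀ q ∈ (Γ x).carrier, ∀ q' ∈ (Γ x).carrier, dist q q' < min s 1 → q = q' := by
    intro x q hq q' hq' hd
    have hd1 := hd.trans_le (min_le_right _ _)
    rw [dist_eq_norm] at hd1
    refine sub_eq_zero.1 (hgap _ (sub_mem_diffSet_of_mem_hull hloc (hΓP x) hq hq') 0
      (by simpa using sub_mem_diffSet_of_mem_hull hloc (hΓP x) hq hq) hd1.le (by simp) ?_)
    rw [dist_zero_right, ← dist_eq_norm]
    exact hd.trans_le (min_le_left _ _)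
  obtain ⟨p₀, hp₀⟩ := nonempty_of_mem_hull hP (hΓP x₀)
  obtain ⟨U, hU, p, hpx₀, hpΓ, hpc⟩ := exists_local_selection hΓ (by positivity) hsep x₀ hp₀
  obtain ⟨V, ⟨hV, hVc⟩, hVU⟩ :=
    (locallyConnectedSpace_iff_connected_basis.1 ‹_› x₀).mem_iff.1 hU
  refine ⟨fun x => p x₀ - p x, by simp, ?_, ?_⟩
  · exact continuousAt_const.sub (hpc.continuousAt hU)
  · filter_upwards [hV] with x hx
    have h := translate_eq_of_isPreconnected hVc hΓ hloc
      (fun x _ q hq q' hq' => sub_mem_diffSet_of_mem_hull hloc (hΓP x) hq hq')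
      (fun x hx => hpΓ x (hVU hx)) (hpc.mono hVU) hx (mem_of_mem_nhds hV)
    have h2 := congrArg (fun Q => Q.translate (-p x)) h
    simp only [translate_translate, neg_add_cancel, translate_zero] at h2
    rw [h2, neg_add_eq_sub]

theorem IsAperiodic.translate_injective {P : Pattern n} (hP : P.IsAperiodic) :
    Function.Injective P.translate := by
  intro a b h
  have h2 := congrArg (fun Q => Q.translate (-b)) h
  simp only [translate_translate, neg_add_cancel, translate_zero] at h2
  have := hP _ h2
  rwa [neg_add_eq_zero, eq_comm] at this

/-- A connected, locally connected continuous family in the hull of `P` that meets the orbit of `P`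
stays in the orbit of `P`. -/
theorem exists_eq_translate {X : Type*} [TopologicalSpace X] [LocallyConnectedSpace X]
    [PreconnectedSpace X] {P : Pattern n} (hP : P.IsDelone) (hflc : P.HasFLC) {Γ : X → Pattern n}
    (hΓ : Continuous Γ) (hΓP : ∀ x, Γ x ∈ P.hull) {x₀ : X} (hx₀ : Γ x₀ = P) (x : X) :
    ∃ v, Γ x = P.translate v := by
  rw [← hx₀]
  refine PreconnectedSpace.induction₂' (fun a b => ∃ v, Γ b = (Γ a).translate v) (fun a => ?_)
    ⟨?_⟩ x₀ x
  · obtain ⟨v, -, -, h⟩ := exists_local_translation hP hflc hΓ hΓP a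
    filter_upwards [h] with b hb
    refine ⟨⟨v b, hb⟩, -v b, ?_⟩
    rw [hb, translate_translate, neg_add_cancel, translate_zero]
  · rintro a b c ⟨v, hv⟩ ⟨w, hw⟩
    exact ⟨w + v, by rw [hw, hv, translate_translate]⟩

theorem continuous_of_eq_translate {X : Type*} [TopologicalSpace X] [LocallyConnectedSpace X]
    {P : Pattern n} (hP : P.IsDelone) (hflc : P.HasFLC) (hap : P.IsAperiodic) {F : X → Euc n}
    (hF : Continuous fun x => P.translate (F x)) : Continuous F := by
  refine continuous_iff_continuousAt.2 fun x₀ => ?_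
  obtain ⟨v, hv0, hvc, hv⟩ := exists_local_translation hP hflc hF
    (fun x => P.translate_mem_hull _) x₀
  have hc : ContinuousAt (fun x => v x + F x₀) x₀ := hvc.add continuousAt_const
  refine hc.congr ?_
  filter_upwards [hv] with x hx
  rw [translate_translate] at hx
  exact (hap.translate_injective hx).symm

end Pattern

/-! ### Increments of the orbit-displacement map are locally determined -/

namespace Pattern

variable {n : ℕ}

theorem IsOrbitDisplacement.coe {P P' : Pattern n} {Φ : P.hull → P'.hull} {F : Euc n → Euc n}
    (hF : IsOrbitDisplacement Φ F) (x : Euc n) :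
    (Φ (P.orbitPoint x) : Pattern n) = P'.translate (F x) := congrArg Subtype.val (hF.1 x)

theorem continuous_orbitPoint (P : Pattern n) : Continuous P.orbitPoint :=
  P.continuous_translate.subtype_mk _

theorem existsUnique_isOrbitDisplacement {P P' : Pattern n} (hP' : P'.IsDelone)
    (hflc : P'.HasFLC) (hap : P'.IsAperiodic) {Φ : P.hull → P'.hull} (hΦ : Continuous Φ)
    (hΦP : Φ P.basePoint = P'.basePoint) : ∃! F : Euc n → Euc n, IsOrbitDisplacement Φ F := by
  have h0 : (Φ (P.orbitPoint 0) : Pattern n) = P' := by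
    have : P.orbitPoint 0 = P.basePoint := Subtype.ext P.translate_zero
    rw [this, hΦP]
    rfl
  have hex := exists_eq_translate hP' hflc
    (continuous_subtype_val.comp (hΦ.comp P.continuous_orbitPoint))
    (fun x => (Φ (P.orbitPoint x)).2) h0
  choose F hF using hex
  refine ⟨F, ⟨fun x => Subtype.ext (hF x), hap _ ((hF 0).symm.trans h0)⟩, fun G hG => ?_⟩
  funext x
  exact hap.translate_injective ((hG.coe x).symm.trans (hF x))

theorem IsOrbitDisplacement.continuous {P P' : Pattern n} (hP' : P'.IsDelone)
    (hflc : P'.HasFLC) (hap : P'.IsAperiodic) {Φ : P.hull → P'.hull} (hΦ : Continuous Φ)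
    {F : Euc n → Euc n} (hF : IsOrbitDisplacement Φ F) : Continuous F := by
  refine continuous_of_eq_translate hP' hflc hap ?_
  have := continuous_subtype_val.comp (hΦ.comp P.continuous_orbitPoint)
  exact this.congr hF.coe

theorem IsOrbitDisplacement.mem_carrier {P P' : Pattern n} {Φ : P.hull → P'.hull}
    (hΦΞ : ∀ Q : P.hull, (Q : Pattern n) ∈ P.discreteHull → (Φ Q : Pattern n) ∈ P'.discreteHull)
    {F : Euc n → Euc n} (hF : IsOrbitDisplacement Φ F) {p : Euc n} (hp : p ∈ P.carrier) :
    F p ∈ P'.carrier := by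
  have h := zero_mem_of_mem_discreteHull (hΦΞ (P.orbitPoint p) (subset_closure ⟨p, hp, rfl⟩))
  rw [hF.coe, mem_translate, zero_add] at h
  exact h

/-- Uniform continuity of `Φ` on the compact hull, read off on the orbit of `P`. -/
theorem IsOrbitDisplacement.exists_near {P P' : Pattern n} {Φ : P.hull → P'.hull}
    (hΦ : Continuous Φ) {F : Euc n → Euc n} (hF : IsOrbitDisplacement Φ F) (W : ℝ) {ε : ℝ}
    (hε : 0 < ε) : ∃ W' ε' : ℝ, 0 < ε' ∧ ∀ x y, Near W' ε' (P.translate x) (P.translate y) →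
      Near W' ε' (P.translate y) (P.translate x) →
      Near W ε (P'.translate (F x)) (P'.translate (F y)) := by
  obtain ⟨δ, hδ, hN⟩ := exists_near_of_edist_lt (n := n) W hε
  obtain ⟨δ', hδ', hu⟩ := EMetric.uniformContinuous_iff.1
    (CompactSpace.uniformContinuous_of_continuous hΦ) δ hδ
  obtain ⟨W', ε', hε', h⟩ := exists_edist_lt_of_near (n := n) hδ'
  refine ⟨W', ε', hε', fun x y hxy hyx => ?_⟩
  rw [← hF.coe, ← hF.coe]
  exact hN _ _ (hu (a := P.orbitPoint x) (b := P.orbitPoint y) (h _ _ hxy hyx))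

/-- A connected set in a neighbourhood of a separated set stays near one point of that set. -/
theorem dist_lt_of_isPreconnected {A : Set (Euc n)} {ε : ℝ}
    (hA : ∀ a ∈ A, ∀ b ∈ A, dist a b < 2 * ε → a = b) {S : Set (Euc n)} (hS : IsPreconnected S)
    {c : Euc n → Euc n} (hc : Continuous c) (hcA : ∀ x ∈ S, ∃ a ∈ A, dist (c x) a < ε)
    {x y a : Euc n} (hx : x ∈ S) (hy : y ∈ S) (ha : a ∈ A) (hxa : dist (c x) a < ε) :
    dist (c y) a < ε := by
  refine (hS.induction₂ (fun z w => dist (c z) a < ε ↔ dist (c w) a < ε) (fun z hz => ?_)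
    (fun _ _ _ _ _ _ h h' => h.trans h') (fun _ _ _ _ h => h.symm) hx hy).1 hxa
  obtain ⟨b, hb, hzb⟩ := hcA z hz
  have hev : ∀ᶠ w in 𝓝[S] z, dist (c w) b < ε :=
    nhdsWithin_le_nhds ((isOpen_ball.preimage hc).mem_nhds hzb)
  filter_upwards [hev] with w hwb
  have key : ∀ u, dist (c u) b < ε → dist (c u) a < ε → b = a := fun u hub hua =>
    hA b hb a ha (by linarith [dist_triangle_left b a (c u)])
  constructor
  · intro h
    rwa [← key z hzb h]
  · intro h
    rwa [← key w hwb h]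

/-- Points at bounded distance have bounded displacement increments. -/
theorem IsOrbitDisplacement.exists_bound {P P' : Pattern n} (hP' : P'.IsDelone)
    (hflc : P'.HasFLC) (hap : P'.IsAperiodic) {Φ : P.hull → P'.hull} (hΦ : Continuous Φ)
    {F : Euc n → Euc n} (hF : IsOrbitDisplacement Φ F) (r : ℝ) :
    ∃ M : ℝ, ∀ x y, dist x y ≤ r → dist (F x) (F y) ≤ M := by
  have hFc := hF.continuous hP' hflc hap hΦ
  obtain ⟨s, hs, hsep⟩ := hP'.exists_separation
  obtain ⟨ρ, hρ, hcov⟩ := hP'.exists_covering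
  obtain ⟨W, η, hη, hN⟩ := hF.exists_near hΦ ρ (half_pos hs)
  have hstep : ∀ x y, dist x y < η → dist (F x) (F y) < s / 2 := by
    intro x y hxy
    obtain ⟨p, hp, hpx⟩ := hcov (F x)
    -- Follow the point `p - F x` of the pattern at `x` along the ball about `x`.
    have h := dist_lt_of_isPreconnected (A := P'.carrier) (ε := s / 2)
      (c := fun z => p - F x + F z) (by simpa [mul_div_cancel₀] using hsep)
      (convex_ball x η).isPreconnected (by fun_prop) (fun z hz => ?_) (mem_ball_self hη)
      (mem_ball'.2 hxy) hp (by simpa using half_pos hs)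
    · simp only [dist_eq_norm] at h ⊢
      rw [show p - F x + F y - p = F y - F x by abel] at h
      rwa [norm_sub_rev]
    · rw [mem_ball'] at hz
      obtain ⟨w, hw, hd⟩ := hN x z (near_translate P hz) (near_translate P (by rwa [dist_comm]))
        (p - F x) (by simpa [mem_translate] using hp) (by rwa [← dist_eq_norm, dist_comm])
      exact ⟨w + F z, hw, by rwa [dist_add_right]⟩
  have hchain : ∀ k : ℕ, ∀ x y, dist x y < (k + 1) * η → dist (F x) (F y) < (k + 1) * (s / 2) := by
    intro k
    induction k with
    | zero => intro x y h; simpa using hstep x y (by simpa using h)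
    | succ k ih =>
      intro x y h
      push_cast at h ⊢
      obtain ⟨z, hxz, hzy⟩ := exists_dist_lt_lt (x := x) (z := y) (δ := (k + 1) * η) (ε := η)
        (by positivity) hη (by linarith)
      linarith [ih x z hxz, hstep z y hzy, dist_triangle (F x) (F z) (F y)]
  obtain ⟨k, hk⟩ := exists_nat_gt (r / η)
  rw [div_lt_iff₀ hη] at hk
  exact ⟨(k + 1) * (s / 2), fun x y h => (hchain k x y (by linarith)).le⟩

theorem near_of_patch_eq {P Q : Pattern n} {R W ε : ℝ} {v : Euc n} (hε : 0 < ε)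
    (h : patch R P = patch R Q) (hR : W + ‖v‖ < R) :
    Near W ε (P.translate v) (Q.translate v) := by
  intro z hz hzW
  have : z + v ∈ patch R P :=
    ⟨mem_ball_zero_iff.2 ((norm_add_le _ _).trans_lt (by linarith)), hz⟩
  rw [h] at this
  exact ⟨z, this.2, by simpa using hε⟩

/-- The increment `φ_P (x + v) - φ_P x` between points `x, x + v` of `P` with `‖v‖ ≤ r` depends only
on a patch of `P` around `x` of bounded radius. -/
theorem IsOrbitDisplacement.exists_increment_eq {P P' : Pattern n} (hP' : P'.IsDelone)
    (hflc : P'.HasFLC) (hap : P'.IsAperiodic) {Φ : P.hull → P'.hull} (hΦ : Continuous Φ)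
    (hΦΞ : ∀ Q : P.hull, (Q : Pattern n) ∈ P.discreteHull → (Φ Q : Pattern n) ∈ P'.discreteHull)
    {F : Euc n → Euc n} (hF : IsOrbitDisplacement Φ F) {r : ℝ} (hr : 0 ≤ r) :
    ∃ R : ℝ, r < R ∧ ∀ x ∈ P.carrier, ∀ y ∈ P.carrier,
      patch R (P.translate x) = patch R (P.translate y) →
      ∀ v : Euc n, ‖v‖ ≤ r → x + v ∈ P.carrier → F (x + v) - F x = F (y + v) - F y := by
  have hFc := hF.continuous hP' hflc hap hΦ
  obtain ⟨M, hM⟩ := hF.exists_bound hP' hflc hap hΦ r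
  obtain ⟨s, hs, hsep⟩ := hP'.exists_separation
  obtain ⟨g, hg, hgap⟩ := (hflc.isLocFinite_diffSet hP').exists_gap M
  have hε : 0 < min (s / 2) g := by positivity
  obtain ⟨W, ε', hε', hN⟩ := hF.exists_near hΦ M hε
  refine ⟨|W| + r + 1, by linarith [abs_nonneg W], fun x hx y hy hxy v hv hxv => ?_⟩
  have hW := le_abs_self W
  have hyv : y + v ∈ P.carrier := by
    have : v ∈ patch (|W| + r + 1) (P.translate x) :=
      ⟨mem_ball_zero_iff.2 (by linarith [abs_nonneg W]), by rwa [mem_translate, add_comm]⟩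
    rw [hxy] at this
    simpa [mem_translate, add_comm] using this.2
  have hMx : ∀ z w : Euc n, ‖w‖ ≤ r → ‖F z - F (z + w)‖ ≤ M := fun z w hw => by
    rw [← dist_eq_norm]
    exact hM _ _ (by simpa using hw)
  -- Seen from `y + w`, the pattern `P' - F (y + w)` has a point near `F x - F (x + w)`.
  have h := dist_lt_of_isPreconnected (A := P'.carrier) (ε := min (s / 2) g)
    (c := fun w => F x - F (x + w) + F (y + w)) (x := 0) (y := v) (a := F y)
    (fun a ha b hb hab => hsep a ha b hb (by linarith [min_le_left (s / 2) g]))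
    (convex_closedBall (0 : Euc n) r).isPreconnected (by fun_prop) (fun w hw => ?_)
    (by simpa using hr) (by simpa using hv) (hF.mem_carrier hΦΞ hy) (by simpa using hε)
  · refine hgap _ ⟨_, hF.mem_carrier hΦΞ hxv, _, hF.mem_carrier hΦΞ hx, rfl⟩ _
      ⟨_, hF.mem_carrier hΦΞ hyv, _, hF.mem_carrier hΦΞ hy, rfl⟩
      (by rw [norm_sub_rev]; exact hMx x v hv) (by rw [norm_sub_rev]; exact hMx y v hv) ?_
    refine lt_of_eq_of_lt ?_ (h.trans_le (min_le_right _ _))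
    simp only [dist_eq_norm]
    rw [← norm_neg]
    congr 1
    abel
  · rw [mem_closedBall_zero_iff] at hw
    have hn := near_of_patch_eq (W := W) (v := w) hε' hxy (by linarith)
    have hn' := near_of_patch_eq (W := W) (v := w) hε' hxy.symm (by linarith)
    rw [translate_translate, translate_translate, add_comm w, add_comm w] at hn hn'
    obtain ⟨q, hq, hd⟩ := hN _ _ hn hn' (F x - F (x + w))
      (by simpa [mem_translate] using hF.mem_carrier hΦΞ hx) (hMx x w hw)
    exact ⟨q + F (y + w), hq, by rwa [dist_add_right]⟩

end Pattern

/-! ### Smooth interpolation of a function on a Delone set -/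

namespace Pattern

variable {n : ℕ} {V : Type*} [NormedAddCommGroup V] [NormedSpace ℝ V]

/-- The sum `∑ κ (x - p) f p` over the points `p` of `P`; for a kernel `κ` of bounded support and a
Delone set `P` it has finitely many non-zero terms. -/
noncomputable def kernelSum (P : Pattern n) (κ : Euc n → ℝ) (f : Euc n → V) (x : Euc n) : V :=
  ∑ᶠ p, P.carrier.indicator (fun p => κ (x - p) • f p) p

theorem kernelSum_eq_sum {P : Pattern n} (hP : P.IsDelone) {κ : Euc n → ℝ} {ρ : ℝ}
    (hκ : ∀ z, ρ ≤ ‖z‖ → κ z = 0) (f : Euc n → V) {x₀ x : Euc n} (hx : dist x x₀ ≤ 1) :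
    P.kernelSum κ f x =
      ∑ p ∈ (hP.finite_inter_closedBall x₀ (ρ + 1)).toFinset, κ (x - p) • f p := by
  rw [kernelSum, finsum_eq_sum_of_support_subset]
  · exact Finset.sum_congr rfl fun p hp =>
      indicator_of_mem ((hP.finite_inter_closedBall x₀ (ρ + 1)).mem_toFinset.1 hp).2 _
  · intro p hp
    rw [Finite.coe_toFinset]
    have hpP := mem_of_indicator_ne_zero hp
    refine ⟨?_, hpP⟩
    by_contra hfar
    rw [mem_closedBall, not_le] at hfar
    refine hp ?_
    rw [indicator_of_mem hpP, hκ, zero_smul]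
    rw [← dist_eq_norm]
    linarith [dist_triangle_left p x₀ x]

theorem contDiff_kernelSum {P : Pattern n} (hP : P.IsDelone) {κ : Euc n → ℝ} {ρ : ℝ}
    (hκ : ∀ z, ρ ≤ ‖z‖ → κ z = 0) (hκs : ContDiff ℝ ∞ κ) (f : Euc n → V) :
    ContDiff ℝ ∞ (P.kernelSum κ f) := by
  refine contDiff_iff_contDiffAt.2 fun x₀ => ?_
  have hs : ContDiff ℝ ∞ fun x => ∑ p ∈ (hP.finite_inter_closedBall x₀ (ρ + 1)).toFinset,
      κ (x - p) • f p :=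
    ContDiff.sum fun p _ => (hκs.comp (contDiff_id.sub contDiff_const)).smul contDiff_const
  refine hs.contDiffAt.congr_of_eventuallyEq ?_
  filter_upwards [closedBall_mem_nhds x₀ one_pos] with x hx
  exact kernelSum_eq_sum hP hκ f hx

theorem kernelSum_sub_const {P : Pattern n} (hP : P.IsDelone) {κ : Euc n → ℝ} {ρ : ℝ}
    (hκ : ∀ z, ρ ≤ ‖z‖ → κ z = 0) (f : Euc n → V) (c : V) (x : Euc n) :
    P.kernelSum κ (fun p => f p - c) x =
      P.kernelSum κ f x - P.kernelSum κ (fun _ => (1 : ℝ)) x • c := by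
  have hx : dist x x ≤ 1 := by simp
  simp only [kernelSum_eq_sum hP hκ _ hx, smul_sub, Finset.sum_sub_distrib, Finset.sum_smul,
    smul_eq_mul, mul_one]

theorem kernelSum_pos {P : Pattern n} (hP : P.IsDelone) {κ : Euc n → ℝ} {ρ : ℝ}
    (hκ : ∀ z, ρ ≤ ‖z‖ → κ z = 0) (hκ0 : ∀ z, 0 ≤ κ z) {x p : Euc n} (hp : p ∈ P.carrier)
    (hxp : 0 < κ (x - p)) : 0 < P.kernelSum κ (fun _ => (1 : ℝ)) x := by
  have hx : dist x x ≤ 1 := by simp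
  rw [kernelSum_eq_sum hP hκ _ hx]
  refine Finset.sum_pos' (fun q _ => by simpa using hκ0 _) ⟨p, ?_, by simpa using hxp⟩
  rw [Finite.mem_toFinset]
  refine ⟨?_, hp⟩
  by_contra hfar
  rw [mem_closedBall, not_le] at hfar
  refine hxp.ne' (hκ _ ?_)
  rw [← dist_eq_norm, dist_comm]
  linarith

theorem kernelSum_eq_of_mem {P : Pattern n} {κ : Euc n → ℝ} {s : ℝ}
    (hsep : ∀ x ∈ P.carrier, ∀ y ∈ P.carrier, dist x y < s → x = y)
    (hκ : ∀ z, s ≤ ‖z‖ → κ z = 0) (hκ0 : κ 0 = 1) (f : Euc n → V) {p : Euc n}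
    (hp : p ∈ P.carrier) : P.kernelSum κ f p = f p := by
  rw [kernelSum, finsum_eq_single _ p, indicator_of_mem hp, sub_self, hκ0, one_smul]
  intro q hqp
  by_cases hq : q ∈ P.carrier
  · rw [indicator_of_mem hq, hκ, zero_smul]
    rw [← dist_eq_norm]
    by_contra! h
    exact hqp (hsep p hp q hq h).symm
  · exact indicator_of_notMem hq _

/-- `∑ κ (x - p) f p` is determined by the patch around `x` and the values of `f` on it. -/
theorem kernelSum_eq_of_patch_eq {P : Pattern n} {κ : Euc n → ℝ} {ρ R : ℝ}
    (hκ : ∀ z, ρ ≤ ‖z‖ → κ z = 0) {f g : Euc n → V} {x y h : Euc n}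
    (hxy : patch R (P.translate x) = patch R (P.translate y)) (hR : ρ + ‖h‖ ≤ R)
    (hfg : ∀ u, ‖u‖ < ρ + ‖h‖ → x + u ∈ P.carrier → f (x + u) = g (y + u)) :
    P.kernelSum κ f (x + h) = P.kernelSum κ g (y + h) := by
  refine (finsum_comp_equiv (Equiv.addLeft x)).symm.trans
    (Eq.trans (finsum_congr fun u => ?_) (finsum_comp_equiv (Equiv.addLeft y)))
  change P.carrier.indicator _ (x + u) = P.carrier.indicator _ (y + u)
  by_cases hu : ‖u‖ < ρ + ‖h‖
  · have hiff : x + u ∈ P.carrier ↔ y + u ∈ P.carrier := by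
      have := Set.ext_iff.1 hxy u
      simpa [patch, mem_translate, hu.trans_le hR, add_comm u] using this
    by_cases hxu : x + u ∈ P.carrier
    · rw [indicator_of_mem hxu, indicator_of_mem (hiff.1 hxu), hfg u hu hxu,
        add_sub_add_left_eq_sub, add_sub_add_left_eq_sub]
    · rw [indicator_of_notMem hxu, indicator_of_notMem (mt hiff.2 hxu)]
  · have h0 : κ (h - u) = 0 := by
      refine hκ _ ?_
      rw [norm_sub_rev]
      linarith [norm_sub_norm_le u h]
    simp [indicator, h0]

/-- The interpolation of `f` from `P` to all of space: the weighted mean of `f` for the kernel `χ`,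
corrected near the points of `P` by the narrow kernel `β`. If `β 0 = 1` and the support of `β` is
smaller than the separation of `P`, the values at the points of `P` are those of `f`. -/
noncomputable def interpolate (P : Pattern n) (χ β : Euc n → ℝ) (f : Euc n → V) (x : Euc n) : V :=
  P.kernelSum β f x + (1 - P.kernelSum β (fun _ => (1 : ℝ)) x) •
    ((P.kernelSum χ (fun _ => (1 : ℝ)) x)⁻¹ • P.kernelSum χ f x)

/-- The weights of the interpolation add up to one. -/
theorem interpolate_sub_const {P : Pattern n} (hP : P.IsDelone) {χ β : Euc n → ℝ} {ρ s : ℝ}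
    (hχ : ∀ z, ρ ≤ ‖z‖ → χ z = 0) (hβ : ∀ z, s ≤ ‖z‖ → β z = 0) (f : Euc n → V) (c : V)
    {x : Euc n} (hx : P.kernelSum χ (fun _ => (1 : ℝ)) x ≠ 0) :
    P.interpolate χ β (fun p => f p - c) x = P.interpolate χ β f x - c := by
  simp only [interpolate, kernelSum_sub_const hP hχ, kernelSum_sub_const hP hβ, smul_sub,
    inv_smul_smul₀ hx, sub_smul, one_smul]
  abel

/-- A function on a Delone set whose increments over bounded distances are determined by patches of
bounded radius extends to a smooth function with strongly equivariant differential. -/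
theorem exists_contDiff_extension {P : Pattern n} (hP : P.IsDelone) {f : Euc n → V}
    (hf : ∀ r : ℝ, 0 ≤ r → ∃ R : ℝ, r < R ∧ ∀ x ∈ P.carrier, ∀ y ∈ P.carrier,
      patch R (P.translate x) = patch R (P.translate y) →
      ∀ v : Euc n, ‖v‖ ≤ r → x + v ∈ P.carrier → f (x + v) - f x = f (y + v) - f y) :
    ∃ φ : Euc n → V, ContDiff ℝ ∞ φ ∧ P.StronglyEquivariant (fderiv ℝ φ) ∧
      ∀ p ∈ P.carrier, φ p = f p := by
  obtain ⟨s, hs, hsep⟩ := hP.exists_separation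
  obtain ⟨ρ, hρ, hcov⟩ := hP.exists_covering
  let χ : ContDiffBump (0 : Euc n) := ⟨ρ, ρ + 1, hρ, by linarith⟩
  let β : ContDiffBump (0 : Euc n) := ⟨s / 2, s, half_pos hs, half_lt_self hs⟩
  have hχ0 : ∀ z, ρ + 1 ≤ ‖z‖ → χ z = 0 := fun z hz => χ.zero_of_le_dist (by simpa using hz)
  have hβ0 : ∀ z, s ≤ ‖z‖ → β z = 0 := fun z hz => β.zero_of_le_dist (by simpa using hz)
  have hpos : ∀ x, 0 < P.kernelSum χ (fun _ => (1 : ℝ)) x := by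
    intro x
    obtain ⟨p, hp, hxp⟩ := hcov x
    refine kernelSum_pos hP hχ0 (fun z => χ.nonneg) hp ?_
    rw [χ.one_of_mem_closedBall (by simpa [← dist_eq_norm] using hxp)]
    exact one_pos
  have hβ1 : β 0 = 1 := β.one_of_mem_closedBall (mem_closedBall_self β.rIn_pos.le)
  refine ⟨P.interpolate χ β f, ?_, ?_, fun p hp => ?_⟩
  · have hχ1 := contDiff_kernelSum hP hχ0 χ.contDiff (fun _ => (1 : ℝ))
    exact (contDiff_kernelSum hP hβ0 β.contDiff f).add
      ((contDiff_const.sub (contDiff_kernelSum hP hβ0 β.contDiff _)).smul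
        ((hχ1.inv fun x => (hpos x).ne').smul (contDiff_kernelSum hP hχ0 χ.contDiff f)))
  · -- Every point is within `ρ` of a base point `x + u` of `P`, and the interpolation on the unit
    -- ball about `x` only involves points of `P` within `max (ρ + 1) s + 1` of `x`.
    set t : ℝ := max (ρ + 1) s + 1 with ht
    have ht1 : ρ + 1 + 1 ≤ t := by rw [ht]; gcongr; exact le_max_left _ _
    have ht2 : s + 1 ≤ t := by rw [ht]; gcongr; exact le_max_right _ _
    obtain ⟨R, hR, hinc⟩ := hf (t + ρ) (by linarith)
    refine ⟨R + ρ, by linarith, fun x y hxy => ?_⟩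
    have hmem : ∀ u : Euc n, ‖u‖ < R + ρ → (x + u ∈ P.carrier ↔ y + u ∈ P.carrier) := by
      intro u hu
      have := Set.ext_iff.1 hxy u
      simpa [patch, mem_translate, hu, add_comm u] using this
    obtain ⟨p, hp, hxp⟩ := hcov x
    obtain ⟨u, rfl⟩ : ∃ u, p = x + u := ⟨p - x, by abel⟩
    have hu : ‖u‖ ≤ ρ := by simpa using hxp
    have hpy : y + u ∈ P.carrier := (hmem u (by linarith)).1 hp
    have hpatch : patch R (P.translate (x + u)) = patch R (P.translate (y + u)) := by
      ext w
      simp only [patch, mem_inter_iff, mem_ball_zero_iff, mem_translate, and_congr_right_iff]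
      intro hw
      have := hmem (u + w) ((norm_add_le _ _).trans_lt (by linarith))
      rwa [← add_assoc, ← add_assoc, add_comm _ w, add_comm _ w] at this
    have hfg : ∀ w : Euc n, ‖w‖ < t → x + w ∈ P.carrier →
        f (x + w) - f (x + u) = f (y + w) - f (y + u) := by
      intro w hw hxw
      have := hinc _ hp _ hpy hpatch (w - u)
        ((norm_sub_le _ _).trans (by linarith)) (by simpa [add_assoc] using hxw)
      simpa [add_assoc] using this
    have hloc : ∀ h : Euc n, ‖h‖ ≤ 1 → P.interpolate χ β f (x + h) =
        P.interpolate χ β f (y + h) + (f (x + u) - f (y + u)) := by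
      intro h hh
      have key : P.interpolate χ β (fun p => f p - f (x + u)) (x + h) =
          P.interpolate χ β (fun p => f p - f (y + u)) (y + h) := by
        simp only [interpolate]
        rw [kernelSum_eq_of_patch_eq (f := fun p => f p - f (x + u))
            (g := fun p => f p - f (y + u)) hχ0 hxy (by linarith) fun w hw => hfg w (by linarith),
          kernelSum_eq_of_patch_eq (f := fun p => f p - f (x + u))
            (g := fun p => f p - f (y + u)) hβ0 hxy (by linarith) fun w hw => hfg w (by linarith),
          kernelSum_eq_of_patch_eq (g := fun _ => (1 : ℝ)) hχ0 hxy (by linarith) fun _ _ _ => rfl,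
          kernelSum_eq_of_patch_eq (g := fun _ => (1 : ℝ)) hβ0 hxy (by linarith) fun _ _ _ => rfl]
      rw [interpolate_sub_const hP hχ0 hβ0 f _ (hpos _).ne',
        interpolate_sub_const hP hχ0 hβ0 f _ (hpos _).ne', sub_eq_sub_iff_add_eq_add] at key
      rw [← add_sub_assoc, eq_sub_iff_add_eq, key]
    have hev : (fun h => P.interpolate χ β f (h + x)) =ᶠ[𝓝 0]
        fun h => P.interpolate χ β f (h + y) + (f (x + u) - f (y + u)) := by
      filter_upwards [closedBall_mem_nhds (0 : Euc n) one_pos] with h hh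
      rw [add_comm h, add_comm h]
      exact hloc h (by simpa using hh)
    have hd := hev.fderiv_eq (𝕜 := ℝ)
    rwa [fderiv_add_const, fderiv_comp_add_right, fderiv_comp_add_right, zero_add, zero_add] at hd
  · rw [interpolate, kernelSum_eq_of_mem hsep hβ0 hβ1 f hp,
      kernelSum_eq_of_mem hsep hβ0 hβ1 (fun _ => (1 : ℝ)) hp, sub_self, zero_smul, add_zero]

end Pattern

theorem mainTheorem2 (n : ℕ) (P P' : Pattern n)
    (hP : P.IsDelone) (hPflc : P.HasFLC) (hPap : P.IsAperiodic)
    (hP' : P'.IsDelone) (hPflc' : P'.HasFLC) (hPap' : P'.IsAperiodic)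
    (Φ : P.hull → P'.hull) (hΦ : Continuous Φ)
    (hΦΞ : ∀ Q : P.hull, (Q : Pattern n) ∈ P.discreteHull → (Φ Q : Pattern n) ∈ P'.discreteHull)
    (hΦP : Φ P.basePoint = P'.basePoint) :
    (∃! φP : Euc n → Euc n, Pattern.IsOrbitDisplacement Φ φP) ∧
    ∀ φP : Euc n → Euc n, Pattern.IsOrbitDisplacement Φ φP →
      ∃ φ : Euc n → Euc n,
        ContDiff ℝ ∞ φ ∧ P.StronglyEquivariant (fderiv ℝ φ) ∧
        (∀ p ∈ P.carrier, φ p = φP p) ∧ (∀ p ∈ P.carrier, φ p ∈ P'.carrier) := by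
  refine ⟨Pattern.existsUnique_isOrbitDisplacement hP' hPflc' hPap' hΦ hΦP, fun φP hφP => ?_⟩
  obtain ⟨φ, hφ, hφe, hφp⟩ := Pattern.exists_contDiff_extension hP (f := φP)
    fun r hr => hφP.exists_increment_eq hP' hPflc' hPap' hΦ hΦΞ hr
  refine ⟨φ, hφ, hφe, hφp, fun p hp => ?_⟩
  rw [hφp p hp]
  exact hφP.mem_carrier hΦΞ hp
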